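/- Let $a,b\in\mathbb{C}$ with $b\neq 0$ and $(a^2-4)(b^2-4)(a^2-1)(b^2-a-2)\neq 0$, and let $C_{a,b}\subset\mathbb{P}^2(\mathbb{C})$ be the (smooth) Kuribayashi quartic $$C_{a,b}:\quad x^4+y^4+z^4+ax^2y^2+b(x^2+y^2)z^2=0 .$$ A point $p\in C_{a,b}$ is a flex if its tangent line $L_p$ has contact order $I_p(C_{a,b},L_p)\ge 3$ with the curve at $p$; it is an ordinary flex if $I_p(C_{a,b},L_p)=3$ and a hyperflex if $I_p(C_{a,b},L_p)=4$. Let $G_1\cong D_4$ be the group of projective transformations generated by $[x:y:z]\mapsto[y:x:z]$ and $[x:y:z]\mapsto[y:-x:z]$; it acts on $C_{a,b}$. Put $$P=a^2+b^2-ab^2,\qquad Q=36-12a+a^2-10b^2+3ab^2 .$$ Then every flex of $C_{a,b}$ is an ordinary flex or a hyperflex, and the following hold, where $k_r$ denotes $k$ orbits of $G_1$ with $r$ points each. 1. If $P=Q=0$, there are exactly $8$ ordinary flexes, forming $1_8$, and exactly $8$ hyperflexes, forming $2_4$. 2. If $P=0$ and $Q\neq 0$, then either there are no ordinary flexes and exactly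 $12$ hyperflexes, forming $1_4$ and $1_8$, or there are exactly $16$ ordinary flexes, forming $2_8$, and exactly $4$ hyperflexes, forming $1_4$. 3. If $P\neq 0$ and $Q=0$, then the same alternative as in case 2 holds. 4. If $PQ\neq 0$, then either there are exactly $24$ ordinary flexes, forming $3_8$, and no hyperflexes, or there are exactly $8$ ordinary flexes, forming $1_8$, and exactly $8$ hyperflexes, forming $1_8$. -/

import Mathlib

open scoped LinearAlgebra.Projectivization MatrixGroups

noncomputable section

namespace Kuribayashi

/-- The complex projective plane. -/
abbrev Plane : Type := ℙ ℂ (Fin 3 → ℂ)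

/-- The set of points of the projective plane curve `F = 0`. For a form `F` (the only case in which
this is used) the condition does not depend on the representative of the point. -/
def curve (F : MvPolynomial (Fin 3) ℂ) : Set Plane :=
  {p | MvPolynomial.eval p.rep F = 0}

/-- The projective tangent line at `p` of the plane curve `F = 0`, as a linear subspace of `ℂ³`:
`F_x(p) x + F_y(p) y + F_z(p) z = 0`. It is a line of the plane when `p` is a smooth point. -/
def tangentLine (F : MvPolynomial (Fin 3) ℂ) (p : Plane) : Submodule ℂ (Fin 3 → ℂ) where
  carrier := {u | ∑ i, MvPolynomial.eval p.rep (MvPolynomial.pderiv i F) * u i = 0}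
  add_mem' := by
    intro u v hu hv
    simp only [Set.mem_ofPred_eq, Pi.add_apply, mul_add, Finset.sum_add_distrib] at *
    rw [hu, hv, add_zero]
  zero_mem' := by simp
  smul_mem' := by
    intro c u hu
    simp only [Set.mem_ofPred_eq, Pi.smul_apply, smul_eq_mul] at *
    rw [← mul_zero c, ← hu, Finset.mul_sum]
    exact Finset.sum_congr rfl fun i _ => by ring

/-- The polynomial `F(v + t w)` in the variable `t`. -/
def restrictToLine (F : MvPolynomial (Fin 3) ℂ) (v w : Fin 3 → ℂ) : Polynomial ℂ :=
  MvPolynomial.aeval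
    (fun i => Polynomial.C (v i) + Polynomial.X * Polynomial.C (w i)) F

/-- The contact order (intersection multiplicity) `I_p(C, L)` at `p` of the curve `C : F = 0` with a
line `L` through `p`: the order of vanishing at `t = 0` of `F(v + t w)`, where `v` represents `p`
and `w` represents another point of `L`; it is `⊤` if `L` is contained in `C`. All choices
of `w` give the same order. -/
def contactOrder (F : MvPolynomial (Fin 3) ℂ) (p : Plane) (L : Submodule ℂ (Fin 3 → ℂ)) : ℕ∞ :=
  ⨅ w ∈ {w : Fin 3 → ℂ | w ∈ L ∧ w ∉ p.submodule},
    emultiplicity Polynomial.X (restrictToLine F p.rep w)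

/-- The flexes of the curve `C : F = 0`: the points at which the tangent line has contact order at
least three with `C`. -/
def flexes (F : MvPolynomial (Fin 3) ℂ) : Set Plane :=
  {p | p ∈ curve F ∧ 3 ≤ contactOrder F p (tangentLine F p)}

/-- The flexes of flex order `i`: those with `I_p(C, L_p) - 2 = i`. -/
def flexesOfOrder (F : MvPolynomial (Fin 3) ℂ) (i : ℕ) : Set Plane :=
  {p | p ∈ flexes F ∧ contactOrder F p (tangentLine F p) = (i : ℕ∞) + 2}

/-- Ordinary flexes: contact order exactly three. -/
def ordinaryFlexes (F : MvPolynomial (Fin 3) ℂ) : Set Plane := flexesOfOrder F 1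

/-- Hyperflexes: contact order exactly four. -/
def hyperflexes (F : MvPolynomial (Fin 3) ℂ) : Set Plane := flexesOfOrder F 2

/-- `x⁴ + y⁴ + z⁴ + a x² y² + b (x² + y²) z²`. -/
def quartic (a b : ℂ) : MvPolynomial (Fin 3) ℂ :=
  MvPolynomial.X 0 ^ 4 + MvPolynomial.X 1 ^ 4 + MvPolynomial.X 2 ^ 4
    + MvPolynomial.C a * (MvPolynomial.X 0 ^ 2 * MvPolynomial.X 1 ^ 2)
    + MvPolynomial.C b * ((MvPolynomial.X 0 ^ 2 + MvPolynomial.X 1 ^ 2) * MvPolynomial.X 2 ^ 2)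

/-- The matrix of `[x : y : z] ↦ [y : x : z]`. -/
def sigma : GL (Fin 3) ℂ :=
  Matrix.GeneralLinearGroup.mkOfDetNeZero !![0, 1, 0; 1, 0, 0; 0, 0, 1]
    (by simp [Matrix.det_fin_three])

/-- The matrix of `[x : y : z] ↦ [y : -x : z]`. -/
def tau : GL (Fin 3) ℂ :=
  Matrix.GeneralLinearGroup.mkOfDetNeZero !![0, 1, 0; -1, 0, 0; 0, 0, 1]
    (by simp [Matrix.det_fin_three])

/-- The group of projective transformations generated by `sigma` and `tau`, a dihedral group of
order eight. -/
def G : Subgroup PGL(Fin 3, ℂ) :=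
  Subgroup.closure {Matrix.ProjGenLinGroup.mk sigma, Matrix.ProjGenLinGroup.mk tau}

/-- `S` is a union of (pairwise distinct) `G`-orbits whose sizes, listed with repetitions, are `m`.
For instance `m = {4, 8}` says that `S` consists of one orbit of four points and one
orbit of eight points, and `m = 0` says that `S` is empty. -/
def HasOrbitSizes (S : Set Plane) (m : Multiset ℕ) : Prop :=
  ∃ T : Finset (Set Plane),
    (∀ O ∈ T, ∃ p : Plane, O = MulAction.orbit G p) ∧
    S = ⋃ O ∈ T, O ∧
    T.val.map Set.ncard = m

/-- `P(a, b) = a² + b² - a b²`. -/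
def P (a b : ℂ) : ℂ := a ^ 2 + b ^ 2 - a * b ^ 2

/-- `Q(a, b) = 36 - 12 a + a² - 10 b² + 3 a b²`. -/
def Q (a b : ℂ) : ℂ := 36 - 12 * a + a ^ 2 - 10 * b ^ 2 + 3 * a * b ^ 2

end Kuribayashi

end

/-!
Every flex has `z ≠ 0`: at a point with `z = 0` the tangent line passes through `[0 : 0 : 1]`, and the
contact order is two (`rep_two_ne_zero`). So let a flex be `[x : y : 1]`, and put `s = x² + y²`. On the
curve `x² y²` is a function of `s`, hence `s` separates the orbits of `G`, which acts by sign changes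
and the exchange of `x` and `y` (`fiber_eq_orbit`).

The curve being smooth, `(m, n) = (f_y, -f_x) / 2` spans the tangent direction, and the contact order
is the first index at which a Taylor coefficient of `f (x + t m, y + t n)` does not vanish. Modulo `f`
the second coefficient is, up to sign, a cubic in `s` (`flexCubic`, essentially the Hessian), and the
third one is a nonzero multiple of `x y (x² - y²)` times the derivative of the cubic in `s`
(`taylorTwo_tangent`, `taylorThree_tangent`). The second, third and fourth coefficients do not all
vanish, because the curve contains no line (`taylorFour_ne_zero`). So the orbits of flexes correspond
to the roots of the cubic, and the hyperflexes lie over the multiple roots and over the roots with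
`x y = 0` or `x² = y²`.

An orbit has eight points unless `x y = 0` or `x² = y²`, when it has four. A root of the first kind
exists, and is then unique, if and only if `P = 0`, and of the second kind if and only if `Q = 0`; these
roots are simple and distinct. The cubic has no triple root. If `α` of its roots are of these two kinds,
`k` are double and `n` are other simple roots, then `α + 2 k + n = 3` (`exists_orbits`), with `α`
determined by the vanishing of `P` and `Q`; this gives the listed cases.
-/

namespace Kuribayashi

section

variable {a b s : ℂ}

/-! ### The cubic of the flexes -/

/-- The cubic in `s = x² + y²` that cuts out the flexes of the quartic on the chart `z = 1`. Up to
sign and modulo the equation of the curve, it is the second derivative of the equation along the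
tangent vector, that is, the Hessian. -/
def flexCubic (a b s : ℂ) : ℂ :=
  (a + 2) * s ^ 2 * (b * s + 6) + (6 + a - b ^ 2) * (3 * b * s + 2)

/-- The derivative of `flexCubic a b` with respect to `s`. -/
def flexCubicDeriv (a b s : ℂ) : ℂ :=
  3 * b * (a + 2) * s ^ 2 + 12 * (a + 2) * s + 3 * b * (6 + a - b ^ 2)

/-- `s` comes from flexes with `x² y² = 0`: it is a root of the cubic and of the numerator
`s² + b s + 1` of `x² y²`. -/
def IsAxisRoot (a b s : ℂ) : Prop := flexCubic a b s = 0 ∧ s ^ 2 + b * s + 1 = 0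

/-- `s` comes from flexes with `x² = y²`: it is a root of the cubic and of the numerator
`(2 + a) s² + 4 b s + 4` of `-(x² - y²)²`. -/
def IsDiagonalRoot (a b s : ℂ) : Prop :=
  flexCubic a b s = 0 ∧ (2 + a) * s ^ 2 + 4 * b * s + 4 = 0

/-- The non-degeneracy conditions on the parameters: `b ≠ 0`, and the conditions for the quartic to
be smooth. The points of the quartic with `z = 0` are no flexes because `b ≠ 0`. -/
structure Admissible (a b : ℂ) : Prop where
  b_ne : b ≠ 0
  a_ne : a ≠ 2
  a_add : a + 2 ≠ 0
  b_sq : b ^ 2 - 4 ≠ 0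
  b_sq_sub : b ^ 2 - a - 2 ≠ 0

/-- Modulo `s² + b s + 1` the cubic is `s (4 - b²) (a s + b)`; the resultant of `a s + b` with
`s² + b s + 1` is `P`. -/
lemma IsAxisRoot.eq (h : Admissible a b) (hs : IsAxisRoot a b s) :
    a * s + b = 0 ∧ P a b = 0 := by
  obtain ⟨h1, h2⟩ := hs
  have hs0 : s ≠ 0 := by rintro rfl; simp at h2
  have h3 : s * (b ^ 2 - 4) * (a * s + b) = 0 := by
    unfold flexCubic at h1
    linear_combination -h1 + (b * (a + 2) * s + 12 + 2 * a - 2 * b ^ 2) * h2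
  have h4 : a * s + b = 0 := by simpa [hs0, h.b_sq] using h3
  refine ⟨h4, ?_⟩
  unfold P
  linear_combination a ^ 2 * h2 - (a * s - b + a * b) * h4

lemma exists_isAxisRoot (h : Admissible a b) (hP : P a b = 0) : ∃ s, IsAxisRoot a b s := by
  unfold P at hP
  have ha : a ≠ 0 := by rintro rfl; exact h.b_ne (by simpa using hP)
  have h2 : (-b / a) ^ 2 + b * (-b / a) + 1 = 0 := by
    field_simp
    linear_combination hP
  refine ⟨-b / a, ?_, h2⟩
  have h4 : a * (-b / a) + b = 0 := by field_simp; ring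
  generalize -b / a = s at *
  unfold flexCubic
  linear_combination (b * (a + 2) * s + 12 + 2 * a - 2 * b ^ 2) * h2 - s * (b ^ 2 - 4) * h4

/-- Modulo `(2 + a) s² + 4 b s + 4` the cubic is a multiple of `(10 - 3 a) b s + 2 (6 - a)`; the
resultant of the latter two is a multiple of `Q`. -/
lemma IsDiagonalRoot.eq (h : Admissible a b) (hs : IsDiagonalRoot a b s) :
    (6 - a) * s + 2 * b = 0 ∧ Q a b = 0 := by
  obtain ⟨h1, h2⟩ := hs
  have hs0 : s ≠ 0 := by rintro rfl; simp at h2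
  have h3 : (10 - 3 * a) * b * s + 2 * (6 - a) = 0 := by
    have : (b ^ 2 - a - 2) * ((10 - 3 * a) * b * s + 2 * (6 - a)) = 0 := by
      unfold flexCubic at h1
      linear_combination (a + 2) * h1
        - ((a + 2) * (b * s + 6) - 4 * b ^ 2) * h2
    simpa [h.b_sq_sub] using this
  have hQ : Q a b = 0 := by
    have : (a + 2) * Q a b = 0 := by
      unfold Q
      linear_combination ((10 - 3 * a) ^ 2 * b ^ 2 * h2 - ((2 + a) * ((10 - 3 * a) * b * s
        - 2 * (6 - a)) + 4 * b ^ 2 * (10 - 3 * a)) * h3) / 4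
    simpa [h.a_add] using this
  refine ⟨?_, hQ⟩
  have ha : 6 - a ≠ 0 := by
    intro h6
    obtain rfl : a = 6 := by linear_combination -h6
    exact mul_ne_zero h.b_ne hs0 (by linear_combination -h3 / 8)
  have : (6 - a) * ((6 - a) * s + 2 * b) = 0 := by
    unfold Q at hQ
    linear_combination b * h3 + s * hQ
  exact (mul_eq_zero.1 this).resolve_left ha

lemma exists_isDiagonalRoot (h : Admissible a b) (hQ : Q a b = 0) :
    ∃ s, IsDiagonalRoot a b s := by
  unfold Q at hQ
  have ha : 6 - a ≠ 0 := by
    intro h6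
    obtain rfl : a = 6 := by linear_combination -h6
    exact h.b_ne (by simpa using (show b ^ 2 = 0 by linear_combination hQ / 8))
  have h2 : (2 + a) * (-2 * b / (6 - a)) ^ 2 + 4 * b * (-2 * b / (6 - a)) + 4 = 0 := by
    field_simp
    linear_combination 4 * hQ
  have h4 : (6 - a) * (-2 * b / (6 - a)) + 2 * b = 0 := by field_simp; ring
  refine ⟨-2 * b / (6 - a), ?_, h2⟩
  generalize -2 * b / (6 - a) = s at *
  have h3 : (6 - a) * ((10 - 3 * a) * b * s + 2 * (6 - a)) = 0 := by
    linear_combination (10 - 3 * a) * b * h4 + 2 * hQ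
  have h5 : (a + 2) * flexCubic a b s = 0 := by
    have := (mul_eq_zero.1 h3).resolve_left ha
    unfold flexCubic
    linear_combination (b ^ 2 - a - 2) * this + ((a + 2) * (b * s + 6) - 4 * b ^ 2) * h2
  exact (mul_eq_zero.1 h5).resolve_left h.a_add

lemma IsAxisRoot.not_isDiagonalRoot (h : Admissible a b) (hs : IsAxisRoot a b s) :
    ¬ IsDiagonalRoot a b s := by
  rintro ⟨-, h2⟩
  have h1 := hs.2
  have : (a - 2) * s ^ 2 = 0 := by linear_combination h2 - 4 * h1
  have hs0 : s = 0 := by simpa [sub_eq_zero, h.a_ne] using this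
  simp [hs0] at h1

/-- For `P = 0`, the derivative at `-b / a` is a nonzero multiple of `(a - 2)²`. -/
lemma IsAxisRoot.flexCubicDeriv_ne (h : Admissible a b) (hs : IsAxisRoot a b s) :
    flexCubicDeriv a b s ≠ 0 := by
  intro h0
  obtain ⟨h1, hP⟩ := hs.eq h
  have ha : a ≠ 0 := by rintro rfl; exact h.b_ne (by simpa using h1)
  unfold flexCubicDeriv at h0
  unfold P at hP
  have h3 : (3 * b) * ((a + 2) * b ^ 2 - 4 * (a + 2) * a + a ^ 2 * (6 + a - b ^ 2)) = 0 := by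
    linear_combination a ^ 2 * h0 - (3 * b * (a + 2) * (a * s - b) + 12 * (a + 2) * a) * h1
  have h4 := (mul_eq_zero.1 h3).resolve_left (mul_ne_zero three_ne_zero h.b_ne)
  have h5 : a * (a - 2) ^ 2 = 0 := by
    linear_combination ((a - 1) * h4 + (a + 2 - a ^ 2) * hP) / 2
  simp [ha, sub_eq_zero, h.a_ne] at h5

/-- For `Q = 0`, the derivative at `-2 b / (6 - a)` is a nonzero multiple of `(a - 2)² (a + 2)`. -/
lemma IsDiagonalRoot.flexCubicDeriv_ne (h : Admissible a b) (hs : IsDiagonalRoot a b s) :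
    flexCubicDeriv a b s ≠ 0 := by
  intro h0
  obtain ⟨h1, hQ⟩ := hs.eq h
  have ha : 6 - a ≠ 0 := by
    intro h6
    exact h.b_ne (by simpa [h6] using h1)
  unfold flexCubicDeriv at h0
  unfold Q at hQ
  have h3 : (3 * b) * (4 * (a + 2) * b ^ 2 - 8 * (a + 2) * (6 - a)
      + (6 - a) ^ 2 * (6 + a - b ^ 2)) = 0 := by
    linear_combination (6 - a) ^ 2 * h0
      - (3 * b * (a + 2) * ((6 - a) * s - 2 * b) + 12 * (a + 2) * (6 - a)) * h1
  have h4 := (mul_eq_zero.1 h3).resolve_left (mul_ne_zero three_ne_zero h.b_ne)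
  have h5 : (6 - a) * (a - 2) ^ 2 * (a + 2) = 0 := by
    linear_combination ((10 - 3 * a) * h4 + (4 * (a + 2) - (6 - a) ^ 2) * hQ) / 4
  simp [ha, sub_eq_zero, h.a_ne, h.a_add] at h5

/-- The cubic has no triple root: it would be `-2 / b`, and this forces
`(b² - 4) (b² - a - 2) = 0`. -/
lemma flexCubic_ne_cube (h : Admissible a b) (t : ℂ) :
    ¬ ∀ s, flexCubic a b s = b * (a + 2) * (s - t) ^ 3 := by
  intro H
  have h0 := H 0
  have h1 := H 1
  have h2 := H (-1)
  unfold flexCubic at h0 h1 h2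
  have h3 : (a + 2) * (b * t + 2) = 0 := by
    linear_combination (h1 + h2 - 2 * h0) / 6
  have h4 : b * t + 2 = 0 := (mul_eq_zero.1 h3).resolve_left h.a_add
  have h5 : (b ^ 2 - 4) * (b ^ 2 - a - 2) = 0 := by
    linear_combination -(b ^ 2 * h0 - (a + 2) * ((b * t) ^ 2 - 2 * (b * t) + 4) * h4) / 2
  simp [h.b_sq, h.b_sq_sub] at h5

end

section

variable {a b x y s : ℂ}

/-! ### The Taylor expansion along the tangent on the chart `z = 1` -/

/-- The equation of the quartic on the chart `z = 1`. -/
def affineQuartic (a b x y : ℂ) : ℂ :=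
  x ^ 4 + y ^ 4 + 1 + a * (x ^ 2 * y ^ 2) + b * (x ^ 2 + y ^ 2)

/-- First coordinate of the tangent vector: half the `y`-derivative of `affineQuartic`. -/
def tangentX (a b x y : ℂ) : ℂ := y * (2 * y ^ 2 + a * x ^ 2 + b)

/-- Second coordinate of the tangent vector: minus half the `x`-derivative of `affineQuartic`. -/
def tangentY (a b x y : ℂ) : ℂ := -(x * (2 * x ^ 2 + a * y ^ 2 + b))

/-- The coefficient of `t²` in `affineQuartic (x + t m) (y + t n)`. -/
def taylorTwo (a b x y m n : ℂ) : ℂ :=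
  6 * x ^ 2 * m ^ 2 + 6 * y ^ 2 * n ^ 2 + a * (x ^ 2 * n ^ 2 + 4 * x * y * m * n + y ^ 2 * m ^ 2)
    + b * (m ^ 2 + n ^ 2)

/-- The coefficient of `t³` in `affineQuartic (x + t m) (y + t n)`. -/
def taylorThree (a x y m n : ℂ) : ℂ :=
  4 * x * m ^ 3 + 4 * y * n ^ 3 + 2 * a * (x * m * n ^ 2 + y * m ^ 2 * n)

/-- The coefficient of `t⁴` in `affineQuartic (x + t m) (y + t n)`. -/
def taylorFour (a m n : ℂ) : ℂ := m ^ 4 + a * (m ^ 2 * n ^ 2) + n ^ 4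

lemma taylorTwo_tangent (h : affineQuartic a b x y = 0) :
    taylorTwo a b x y (tangentX a b x y) (tangentY a b x y) = -flexCubic a b (x ^ 2 + y ^ 2) := by
  unfold affineQuartic at h
  unfold taylorTwo tangentX tangentY flexCubic
  linear_combination (4 * a * (x ^ 4 + y ^ 4) + (24 - 2 * a ^ 2) * x ^ 2 * y ^ 2
    + (a + 6) * b * (x ^ 2 + y ^ 2) + 2 * a - 2 * b ^ 2 + 12) * h

/-- The third derivative along the tangent is the derivative of the second one along the curve,
whence `flexCubicDeriv`; the remaining factor is the derivative of `x² + y²` along the curve. -/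
lemma taylorThree_tangent (h : affineQuartic a b x y = 0) :
    3 * taylorThree a x y (tangentX a b x y) (tangentY a b x y) =
      2 * (2 - a) * (x * y * (x ^ 2 - y ^ 2)) * flexCubicDeriv a b (x ^ 2 + y ^ 2) := by
  unfold affineQuartic at h
  unfold taylorThree tangentX tangentY flexCubicDeriv
  linear_combination (x * y * (x ^ 2 - y ^ 2)) * (24 * (a ^ 2 - 4) * (x ^ 2 + y ^ 2)
    + 6 * a ^ 2 * b + 24 * a * b - 72 * b) * h

lemma tangent_ne_zero (hab : Admissible a b) (h : affineQuartic a b x y = 0) :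
    tangentX a b x y ≠ 0 ∨ tangentY a b x y ≠ 0 := by
  by_contra! hc
  obtain ⟨h1, h2⟩ := hc
  have h2a := sub_ne_zero.2 hab.a_ne
  unfold affineQuartic at h
  simp only [tangentX, tangentY, neg_eq_zero, mul_eq_zero] at h1 h2
  rcases h1 with rfl | h1 <;> rcases h2 with rfl | h2
  · simp at h
  · exact hab.b_sq (by linear_combination (2 * x ^ 2 + b) * h2 - 4 * h)
  · exact hab.b_sq (by linear_combination (2 * y ^ 2 + b) * h1 - 4 * h)
  · have h3 : (a - 2) * (x ^ 2 - y ^ 2) = 0 := by linear_combination h1 - h2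
    have h4 := (mul_eq_zero.1 h3).resolve_left h2a
    have h5 : (a + 2) * x ^ 2 + b = 0 := by linear_combination h2 + a * h4
    have h6 : b * x ^ 2 + 1 = 0 := by
      linear_combination h - x ^ 2 * h5 + (x ^ 2 + y ^ 2 + a * x ^ 2 + b) * h4
    exact hab.b_sq_sub (by linear_combination b * h5 - (a + 2) * h6)

/-- The quartic contains no line: if all Taylor coefficients at `(x, y)` in the direction `(m, n)`
vanish, then `(x, y)` is proportional to `(m, n)` because the binary form `taylorFour` has no
multiple zeros, so the line passes through `(0, 0)`, which is not on the curve. -/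
lemma taylorFour_ne_zero (hab : Admissible a b) {m n : ℂ} (h : affineQuartic a b x y = 0)
    (hmn : m ≠ 0 ∨ n ≠ 0) (h2 : taylorTwo a b x y m n = 0) (h3 : taylorThree a x y m n = 0) :
    taylorFour a m n ≠ 0 := by
  intro h4
  have h2a := sub_ne_zero.2 hab.a_ne
  have ha4 : (a - 2) * (a + 2) ≠ 0 := mul_ne_zero h2a hab.a_add
  unfold affineQuartic at h
  unfold taylorTwo at h2
  unfold taylorThree at h3
  unfold taylorFour at h4
  have key : x * n - y * m = 0 := by
    by_contra hk
    have e1 : m * (2 * m ^ 2 + a * n ^ 2) = 0 := by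
      refine (mul_eq_zero.1 ?_).resolve_left hk
      linear_combination n * h3 / 2 - 2 * y * h4
    have e2 : n * (2 * n ^ 2 + a * m ^ 2) = 0 := by
      refine (mul_eq_zero.1 ?_).resolve_left hk
      linear_combination -m * h3 / 2 + 2 * x * h4
    by_cases hm : m = 0
    · have : n ≠ 0 := by simpa [hm] using hmn
      simp [hm, this] at e2
    · by_cases hn : n = 0
      · simp [hn, hm] at e1
      · have e1' := (mul_eq_zero.1 e1).resolve_left hm
        have e2' := (mul_eq_zero.1 e2).resolve_left hn
        have : (a - 2) * (a + 2) * m ^ 2 = 0 := by linear_combination a * e2' - 2 * e1'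
        exact mul_ne_zero ha4 (pow_ne_zero 2 hm) this
  obtain ⟨μ, rfl, rfl⟩ : ∃ μ, x = μ * m ∧ y = μ * n := by
    rcases hmn with hm | hn
    · exact ⟨x / m, by field_simp, by field_simp; linear_combination -key⟩
    · exact ⟨y / n, by field_simp; linear_combination key, by field_simp⟩
  have : (1 : ℂ) = 0 := by
    linear_combination h - μ ^ 2 * h2 + 5 * μ ^ 4 * h4
  exact one_ne_zero this

/-! ### Contact orders -/

/-- The point `[x : y : 1]`. -/
noncomputable def affinePoint (x y : ℂ) : Plane :=
  Projectivization.mk ℂ ![x, y, 1] fun h => one_ne_zero (congrFun h 2)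

lemma exists_affinePoint_rep (x y : ℂ) :
    ∃ Z : ℂ, Z ≠ 0 ∧ (affinePoint x y).rep = ![Z * x, Z * y, Z] := by
  obtain ⟨Z, hZ⟩ := Projectivization.exists_smul_eq_mk_rep ℂ ![x, y, 1]
    (fun h => one_ne_zero (congrFun h 2))
  refine ⟨Z, Z.ne_zero, hZ.symm.trans ?_⟩
  ext i
  fin_cases i <;> simp [Units.smul_def]

lemma exists_eq_affinePoint {p : Plane} (hp : p.rep 2 ≠ 0) : ∃ x y, p = affinePoint x y := by
  refine ⟨p.rep 0 / p.rep 2, p.rep 1 / p.rep 2, ?_⟩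
  conv_lhs => rw [← p.mk_rep]
  rw [affinePoint, Projectivization.mk_eq_mk_iff']
  refine ⟨p.rep 2, ?_⟩
  ext i
  fin_cases i <;> simp <;> field_simp

lemma affinePoint_inj {x' y' : ℂ} : affinePoint x y = affinePoint x' y' ↔ x = x' ∧ y = y' := by
  refine ⟨fun h => ?_, by rintro ⟨rfl, rfl⟩; rfl⟩
  rw [affinePoint, affinePoint, Projectivization.mk_eq_mk_iff'] at h
  obtain ⟨c, hc⟩ := h
  have h0 := congrFun hc 0
  have h1 := congrFun hc 1
  have h2 := congrFun hc 2
  simp at h0 h1 h2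
  subst h2
  simpa [eq_comm] using And.intro h0 h1

lemma eval_quartic (v : Fin 3 → ℂ) : MvPolynomial.eval v (quartic a b) =
    v 0 ^ 4 + v 1 ^ 4 + v 2 ^ 4 + a * (v 0 ^ 2 * v 1 ^ 2)
      + b * ((v 0 ^ 2 + v 1 ^ 2) * v 2 ^ 2) := by
  simp [quartic]

lemma restrictToLine_quartic (v w : Fin 3 → ℂ) : restrictToLine (quartic a b) v w =
    (.C (v 0) + .X * .C (w 0)) ^ 4 + (.C (v 1) + .X * .C (w 1)) ^ 4
      + (.C (v 2) + .X * .C (w 2)) ^ 4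
      + .C a * ((.C (v 0) + .X * .C (w 0)) ^ 2 * (.C (v 1) + .X * .C (w 1)) ^ 2)
      + .C b * (((.C (v 0) + .X * .C (w 0)) ^ 2 + (.C (v 1) + .X * .C (w 1)) ^ 2)
        * (.C (v 2) + .X * .C (w 2)) ^ 2) := by
  simp [restrictToLine, quartic, Polynomial.algebraMap_eq]

lemma mem_tangentLine_quartic {p : Plane} {u : Fin 3 → ℂ} : u ∈ tangentLine (quartic a b) p ↔
    (4 * p.rep 0 ^ 3 + 2 * a * (p.rep 0 * p.rep 1 ^ 2) + 2 * b * (p.rep 0 * p.rep 2 ^ 2)) * u 0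
    + (4 * p.rep 1 ^ 3 + 2 * a * (p.rep 0 ^ 2 * p.rep 1) + 2 * b * (p.rep 1 * p.rep 2 ^ 2)) * u 1
    + (4 * p.rep 2 ^ 3 + 2 * b * ((p.rep 0 ^ 2 + p.rep 1 ^ 2) * p.rep 2)) * u 2 = 0 := by
  change ∑ i, MvPolynomial.eval p.rep (MvPolynomial.pderiv i (quartic a b)) * u i = 0 ↔ _
  rw [Fin.sum_univ_three]
  simp [quartic, MvPolynomial.pderiv_X]
  ring_nf

lemma affinePoint_mem_curve : affinePoint x y ∈ curve (quartic a b) ↔ affineQuartic a b x y = 0 := by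
  obtain ⟨Z, hZ, hrep⟩ := exists_affinePoint_rep x y
  have : MvPolynomial.eval (affinePoint x y).rep (quartic a b) = Z ^ 4 * affineQuartic a b x y := by
    rw [eval_quartic, hrep]
    simp [affineQuartic]
    ring
  simp [curve, this, hZ]

lemma emultiplicity_X_eq {q : Polynomial ℂ} (n : ℕ) (hq : q.coeff 0 ≠ 0) :
    emultiplicity Polynomial.X (Polynomial.X ^ n * q) = n := by
  rw [emultiplicity_eq_coe]
  refine ⟨dvd_mul_right _ _, fun h => hq ?_⟩
  rw [pow_succ, mul_dvd_mul_iff_left (pow_ne_zero _ Polynomial.X_ne_zero),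
    Polynomial.X_dvd_iff] at h
  exact h

lemma contactOrder_eq {F : MvPolynomial (Fin 3) ℂ} {p : Plane} {L : Submodule ℂ (Fin 3 → ℂ)}
    {n : ℕ} (hL : ∃ w ∈ L, w ∉ p.submodule)
    (h : ∀ w ∈ L, w ∉ p.submodule →
      ∃ q : Polynomial ℂ, q.coeff 0 ≠ 0 ∧ restrictToLine F p.rep w = Polynomial.X ^ n * q) :
    contactOrder F p L = n := by
  have key : ∀ w ∈ L, w ∉ p.submodule →
      emultiplicity Polynomial.X (restrictToLine F p.rep w) = n := by
    intro w h1 h2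
    obtain ⟨q, hq, e⟩ := h w h1 h2
    rw [e, emultiplicity_X_eq n hq]
  obtain ⟨w, h1, h2⟩ := hL
  refine le_antisymm (iInf₂_le_of_le w ⟨h1, h2⟩ (key w h1 h2).le) ?_
  exact le_iInf₂ fun w hw => (key w hw.1 hw.2).ge

/-- Every point of the tangent line other than the point of contact has the form
`α (x, y, 1) + β (m, n, 0)` with `β ≠ 0`. -/
lemma exists_of_mem_tangentLine (hab : Admissible a b) (h : affineQuartic a b x y = 0)
    {w : Fin 3 → ℂ} (hw : w ∈ tangentLine (quartic a b) (affinePoint x y))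
    (hw' : w ∉ (affinePoint x y).submodule) :
    ∃ α β : ℂ, β ≠ 0 ∧
      w = ![α * x + β * tangentX a b x y, α * y + β * tangentY a b x y, α] := by
  obtain ⟨Z, hZ, hrep⟩ := exists_affinePoint_rep x y
  rw [mem_tangentLine_quartic, hrep] at hw
  simp at hw
  have e : tangentX a b x y * (w 1 - w 2 * y) - tangentY a b x y * (w 0 - w 2 * x) = 0 := by
    have : (2 * Z ^ 3) * (tangentX a b x y * (w 1 - w 2 * y)
        - tangentY a b x y * (w 0 - w 2 * x)) = 0 := by
      unfold tangentX tangentY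
      unfold affineQuartic at h
      linear_combination hw - 4 * Z ^ 3 * w 2 * h
    simpa [hZ] using this
  obtain ⟨β, h0, h1⟩ : ∃ β, w 0 - w 2 * x = β * tangentX a b x y ∧
      w 1 - w 2 * y = β * tangentY a b x y := by
    rcases tangent_ne_zero hab h with hm | hn
    · exact ⟨(w 0 - w 2 * x) / tangentX a b x y, by field_simp,
        by field_simp; linear_combination e⟩
    · exact ⟨(w 1 - w 2 * y) / tangentY a b x y, by field_simp; linear_combination -e,
        by field_simp⟩
  have hwe : w = ![w 2 * x + β * tangentX a b x y, w 2 * y + β * tangentY a b x y, w 2] := by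
    ext i
    fin_cases i
    · simp; linear_combination h0
    · simp; linear_combination h1
    · simp
  refine ⟨w 2, β, ?_, hwe⟩
  rintro rfl
  apply hw'
  rw [affinePoint, Projectivization.submodule_mk, Submodule.mem_span_singleton]
  refine ⟨w 2, ?_⟩
  rw [hwe]
  ext i
  fin_cases i <;> simp

lemma exists_mem_tangentLine (hab : Admissible a b) (h : affineQuartic a b x y = 0) :
    ∃ w ∈ tangentLine (quartic a b) (affinePoint x y), w ∉ (affinePoint x y).submodule := by
  refine ⟨![tangentX a b x y, tangentY a b x y, 0], ?_, ?_⟩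
  · obtain ⟨Z, hZ, hrep⟩ := exists_affinePoint_rep x y
    rw [mem_tangentLine_quartic, hrep]
    simp [tangentX, tangentY]
    ring
  · rw [affinePoint, Projectivization.submodule_mk, Submodule.mem_span_singleton]
    rintro ⟨c, hc⟩
    have h0 := congrFun hc 0
    have h1 := congrFun hc 1
    have h2 := congrFun hc 2
    simp at h0 h1 h2
    rcases tangent_ne_zero hab h with hm | hn
    · exact hm (by rw [← h0, h2, zero_mul])
    · exact hn (by rw [← h1, h2, zero_mul])

lemma restrictToLine_affine (h : affineQuartic a b x y = 0) (α β Z : ℂ) :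
    restrictToLine (quartic a b) ![Z * x, Z * y, Z]
      ![α * x + β * tangentX a b x y, α * y + β * tangentY a b x y, α] =
    .C (taylorTwo a b x y (tangentX a b x y) (tangentY a b x y) * β ^ 2)
        * (.X ^ 2 * (.C Z + .C α * .X) ^ 2)
      + .C (taylorThree a x y (tangentX a b x y) (tangentY a b x y) * β ^ 3)
        * (.X ^ 3 * (.C Z + .C α * .X))
      + .C (taylorFour a (tangentX a b x y) (tangentY a b x y) * β ^ 4) * .X ^ 4 := by
  have h' := congrArg (Polynomial.C (R := ℂ)) h
  have e1 : 2 * (2 * x ^ 2 + a * y ^ 2 + b) * x * tangentX a b x y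
      + 2 * (2 * y ^ 2 + a * x ^ 2 + b) * y * tangentY a b x y = 0 := by
    unfold tangentX tangentY; ring
  have e1' := congrArg (Polynomial.C (R := ℂ)) e1
  rw [restrictToLine_quartic]
  generalize tangentX a b x y = m at *
  generalize tangentY a b x y = n at *
  unfold affineQuartic at h'
  unfold taylorTwo taylorThree taylorFour
  simp only [map_add, map_mul, map_pow, map_one, map_zero, map_ofNat, Matrix.cons_val_zero,
    Matrix.cons_val_one, Matrix.cons_val] at *
  linear_combination (.C Z + .C α * .X) ^ 4 * h'
    + .C β * .X * (.C Z + .C α * .X) ^ 3 * e1'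

lemma contactOrder_affinePoint_of_taylorTwo (hab : Admissible a b)
    (h : affineQuartic a b x y = 0)
    (h2 : taylorTwo a b x y (tangentX a b x y) (tangentY a b x y) ≠ 0) :
    contactOrder (quartic a b) (affinePoint x y)
      (tangentLine (quartic a b) (affinePoint x y)) = (2 : ℕ) := by
  refine contactOrder_eq (exists_mem_tangentLine hab h) fun w hw hw' => ?_
  obtain ⟨α, β, hβ, rfl⟩ := exists_of_mem_tangentLine hab h hw hw'
  obtain ⟨Z, hZ, hrep⟩ := exists_affinePoint_rep x y
  rw [hrep, restrictToLine_affine h]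
  generalize taylorThree _ _ _ _ _ = c3
  generalize taylorFour _ _ _ = c4
  generalize taylorTwo _ _ _ _ _ _ = c2 at *
  refine ⟨.C (c2 * β ^ 2) * (.C Z + .C α * .X) ^ 2 + .X * (.C (c3 * β ^ 3) * (.C Z + .C α * .X)
    + .C (c4 * β ^ 4) * .X), ?_, by ring⟩
  simp [Polynomial.coeff_zero_eq_eval_zero, h2, hβ, hZ]

lemma contactOrder_affinePoint_of_taylorThree (hab : Admissible a b)
    (h : affineQuartic a b x y = 0)
    (h2 : taylorTwo a b x y (tangentX a b x y) (tangentY a b x y) = 0)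
    (h3 : taylorThree a x y (tangentX a b x y) (tangentY a b x y) ≠ 0) :
    contactOrder (quartic a b) (affinePoint x y)
      (tangentLine (quartic a b) (affinePoint x y)) = (3 : ℕ) := by
  refine contactOrder_eq (exists_mem_tangentLine hab h) fun w hw hw' => ?_
  obtain ⟨α, β, hβ, rfl⟩ := exists_of_mem_tangentLine hab h hw hw'
  obtain ⟨Z, hZ, hrep⟩ := exists_affinePoint_rep x y
  rw [hrep, restrictToLine_affine h, h2]
  generalize taylorThree _ _ _ _ _ = c3 at *
  generalize taylorFour _ _ _ = c4
  refine ⟨.C (c3 * β ^ 3) * (.C Z + .C α * .X) + .C (c4 * β ^ 4) * .X, ?_, ?_⟩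
  · simp [Polynomial.coeff_zero_eq_eval_zero, h3, hβ, hZ]
  · simp only [zero_mul, map_zero]
    ring

lemma contactOrder_affinePoint_of_taylorFour (hab : Admissible a b)
    (h : affineQuartic a b x y = 0)
    (h2 : taylorTwo a b x y (tangentX a b x y) (tangentY a b x y) = 0)
    (h3 : taylorThree a x y (tangentX a b x y) (tangentY a b x y) = 0) :
    contactOrder (quartic a b) (affinePoint x y)
      (tangentLine (quartic a b) (affinePoint x y)) = (4 : ℕ) := by
  have h4 := taylorFour_ne_zero hab h (tangent_ne_zero hab h) h2 h3
  refine contactOrder_eq (exists_mem_tangentLine hab h) fun w hw hw' => ?_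
  obtain ⟨α, β, hβ, rfl⟩ := exists_of_mem_tangentLine hab h hw hw'
  obtain ⟨Z, hZ, hrep⟩ := exists_affinePoint_rep x y
  rw [hrep, restrictToLine_affine h, h2, h3]
  refine ⟨.C (taylorFour a (tangentX a b x y) (tangentY a b x y) * β ^ 4), ?_, ?_⟩
  · rw [Polynomial.coeff_C_zero]
    exact mul_ne_zero h4 (pow_ne_zero 4 hβ)
  · simp only [zero_mul, map_zero]
    ring

/-- There is no flex on the line `z = 0`: there the tangent line passes through `[0 : 0 : 1]`, and
its contact order is two. -/
lemma rep_two_ne_zero (hab : Admissible a b) {p : Plane} (hp : p ∈ flexes (quartic a b)) :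
    p.rep 2 ≠ 0 := by
  intro hz
  obtain ⟨h1, h2⟩ := hp
  have h1' : MvPolynomial.eval p.rep (quartic a b) = 0 := h1
  rw [eval_quartic] at h1'
  have hne := p.rep_nonzero
  have hxy : p.rep 0 ^ 2 + p.rep 1 ^ 2 ≠ 0 := by
    intro h
    have h2a := sub_ne_zero.2 hab.a_ne
    have hy : (a - 2) * p.rep 1 ^ 4 = 0 := by
      rw [hz] at h1'
      linear_combination (p.rep 0 ^ 2 - p.rep 1 ^ 2 + a * p.rep 1 ^ 2) * h - h1'
    have hy : p.rep 1 = 0 := by simpa [h2a] using hy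
    have hx : p.rep 0 = 0 := by simpa [hy] using h
    refine hne ?_
    ext i
    fin_cases i <;> simp [hx, hy, hz]
  have hle : contactOrder (quartic a b) p (tangentLine (quartic a b) p) ≤ (2 : ℕ) := by
    refine iInf₂_le_of_le ![0, 0, 1] ⟨?_, ?_⟩ ?_
    · rw [mem_tangentLine_quartic]
      simp [hz]
    · rw [Projectivization.submodule_eq, Submodule.mem_span_singleton]
      rintro ⟨c, hc⟩
      simpa [hz] using congrFun hc 2
    · have : restrictToLine (quartic a b) p.rep ![0, 0, 1] = Polynomial.X ^ 2 *
          (.C (b * (p.rep 0 ^ 2 + p.rep 1 ^ 2)) + .X ^ 2) := by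
        have := congrArg (Polynomial.C (R := ℂ)) h1'
        rw [restrictToLine_quartic]
        simp [hz] at this ⊢
        linear_combination this
      rw [this, emultiplicity_X_eq]
      simp [Polynomial.coeff_zero_eq_eval_zero, hab.b_ne, hxy]
  exact absurd (h2.trans hle) (by decide)

/-- The contact order along the tangent at `[x : y : 1]` is governed by the cubic. -/
lemma affinePoint_mem_flexes (hab : Admissible a b) : affinePoint x y ∈ flexes (quartic a b) ↔
    affineQuartic a b x y = 0 ∧ flexCubic a b (x ^ 2 + y ^ 2) = 0 := by
  rw [flexes, Set.mem_ofPred_eq, affinePoint_mem_curve]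
  refine and_congr_right fun h => ?_
  rw [← neg_eq_zero, ← taylorTwo_tangent h]
  by_cases h2 : taylorTwo a b x y (tangentX a b x y) (tangentY a b x y) = 0
  · by_cases h3 : taylorThree a x y (tangentX a b x y) (tangentY a b x y) = 0
    · rw [contactOrder_affinePoint_of_taylorFour hab h h2 h3]
      simp only [h2, iff_true]
      decide
    · rw [contactOrder_affinePoint_of_taylorThree hab h h2 h3]
      simp only [h2, iff_true]
      decide
  · rw [contactOrder_affinePoint_of_taylorTwo hab h h2]
    simp only [h2, iff_false]
    decide

lemma taylorThree_eq_zero_iff (hab : Admissible a b) (h : affineQuartic a b x y = 0) :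
    taylorThree a x y (tangentX a b x y) (tangentY a b x y) = 0 ↔
      x * y * (x ^ 2 - y ^ 2) = 0 ∨ flexCubicDeriv a b (x ^ 2 + y ^ 2) = 0 := by
  have h2a : 2 * (2 - a) ≠ 0 := mul_ne_zero two_ne_zero (sub_ne_zero.2 hab.a_ne.symm)
  rw [← mul_eq_zero, ← mul_right_inj' (three_ne_zero (α := ℂ)), taylorThree_tangent h, mul_zero,
    mul_assoc, mul_eq_zero_iff_left h2a]

lemma contactOrder_of_mem_flexes (hab : Admissible a b)
    (hp : affinePoint x y ∈ flexes (quartic a b)) :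
    contactOrder (quartic a b) (affinePoint x y) (tangentLine (quartic a b) (affinePoint x y)) = 3 ∧
      ¬ (x * y * (x ^ 2 - y ^ 2) = 0 ∨ flexCubicDeriv a b (x ^ 2 + y ^ 2) = 0) ∨
    contactOrder (quartic a b) (affinePoint x y) (tangentLine (quartic a b) (affinePoint x y)) = 4 ∧
      (x * y * (x ^ 2 - y ^ 2) = 0 ∨ flexCubicDeriv a b (x ^ 2 + y ^ 2) = 0) := by
  obtain ⟨h, hr⟩ := (affinePoint_mem_flexes hab).1 hp
  rw [← taylorThree_eq_zero_iff hab h]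
  rw [← neg_eq_zero, ← taylorTwo_tangent h] at hr
  by_cases h3 : taylorThree a x y (tangentX a b x y) (tangentY a b x y) = 0
  · exact .inr ⟨contactOrder_affinePoint_of_taylorFour hab h hr h3, h3⟩
  · exact .inl ⟨contactOrder_affinePoint_of_taylorThree hab h hr h3, h3⟩

/-- A flex at which neither `x y (x² - y²)` nor the derivative of the cubic vanishes is ordinary. -/
lemma affinePoint_mem_ordinaryFlexes (hab : Admissible a b) :
    affinePoint x y ∈ ordinaryFlexes (quartic a b) ↔ affinePoint x y ∈ flexes (quartic a b) ∧
      ¬ (x * y * (x ^ 2 - y ^ 2) = 0 ∨ flexCubicDeriv a b (x ^ 2 + y ^ 2) = 0) := by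
  refine and_congr_right fun hp => ?_
  rcases contactOrder_of_mem_flexes hab hp with ⟨h, h'⟩ | ⟨h, h'⟩
  · simp only [h, h', not_false_eq_true, iff_true]
    rfl
  · simp only [h, h', not_true_eq_false, iff_false]
    decide

lemma affinePoint_mem_hyperflexes (hab : Admissible a b) :
    affinePoint x y ∈ hyperflexes (quartic a b) ↔ affinePoint x y ∈ flexes (quartic a b) ∧
      (x * y * (x ^ 2 - y ^ 2) = 0 ∨ flexCubicDeriv a b (x ^ 2 + y ^ 2) = 0) := by
  refine and_congr_right fun hp => ?_
  rcases contactOrder_of_mem_flexes hab hp with ⟨h, h'⟩ | ⟨h, h'⟩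
  · simp only [h, h', iff_false]
    decide
  · simp only [h, h', iff_true]
    rfl

lemma flexes_eq_union (hab : Admissible a b) : flexes (quartic a b) =
    ordinaryFlexes (quartic a b) ∪ hyperflexes (quartic a b) := by
  ext p
  refine ⟨fun hp => ?_, fun hp => hp.elim And.left And.left⟩
  obtain ⟨x, y, rfl⟩ := exists_eq_affinePoint (rep_two_ne_zero hab hp)
  rw [Set.mem_union, affinePoint_mem_ordinaryFlexes hab, affinePoint_mem_hyperflexes hab]
  tauto

end

section

variable {a b x y s : ℂ}

/-! ### Orbits of the dihedral group -/

/-- The points `[x : y : 1]` of the quartic with `x² + y² = s`; the second equation is that of the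
quartic, solved for `x² y²`. -/
def fiber (a b s : ℂ) : Set Plane :=
  {p | ∃ x y, p = affinePoint x y ∧ x ^ 2 + y ^ 2 = s ∧
    (2 - a) * (x ^ 2 * y ^ 2) = s ^ 2 + b * s + 1}

lemma affineQuartic_eq_zero_iff : affineQuartic a b x y = 0 ↔
    (2 - a) * (x ^ 2 * y ^ 2) = (x ^ 2 + y ^ 2) ^ 2 + b * (x ^ 2 + y ^ 2) + 1 := by
  unfold affineQuartic
  constructor <;> intro h <;> linear_combination -h

lemma affinePoint_mem_fiber : affinePoint x y ∈ fiber a b s ↔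
    affineQuartic a b x y = 0 ∧ x ^ 2 + y ^ 2 = s := by
  rw [affineQuartic_eq_zero_iff]
  constructor
  · rintro ⟨x', y', h, rfl, h2⟩
    obtain ⟨rfl, rfl⟩ := affinePoint_inj.1 h
    exact ⟨h2, rfl⟩
  · rintro ⟨h, rfl⟩
    exact ⟨x, y, rfl, rfl, h⟩

lemma exists_mem_fiber (h : Admissible a b) (s : ℂ) : ∃ x y : ℂ, affinePoint x y ∈ fiber a b s := by
  have h2a : 2 - a ≠ 0 := sub_ne_zero.2 h.a_ne.symm
  obtain ⟨d, hd⟩ := IsAlgClosed.exists_pow_nat_eq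
    (s ^ 2 - 4 * ((s ^ 2 + b * s + 1) / (2 - a))) two_pos
  obtain ⟨x, hx⟩ := IsAlgClosed.exists_pow_nat_eq ((s + d) / 2) two_pos
  obtain ⟨y, hy⟩ := IsAlgClosed.exists_pow_nat_eq ((s - d) / 2) two_pos
  refine ⟨x, y, x, y, rfl, by rw [hx, hy]; ring, ?_⟩
  rw [hx, hy]
  have : (s + d) / 2 * ((s - d) / 2) = (s ^ 2 + b * s + 1) / (2 - a) := by
    linear_combination -hd / 4
  rw [this]
  field_simp

lemma sigma_smul (x y : ℂ) :
    (Matrix.ProjGenLinGroup.mk sigma : PGL(Fin 3, ℂ)) • affinePoint x y = affinePoint y x := by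
  rw [affinePoint, Projectivization.PGL.mk_smul_mk, affinePoint]
  congr 1
  ext i
  fin_cases i <;>
    simp [sigma, Matrix.GeneralLinearGroup.mkOfDetNeZero, Units.smul_def, Matrix.mulVec]

lemma tau_smul (x y : ℂ) :
    (Matrix.ProjGenLinGroup.mk tau : PGL(Fin 3, ℂ)) • affinePoint x y = affinePoint y (-x) := by
  rw [affinePoint, Projectivization.PGL.mk_smul_mk, affinePoint]
  congr 1
  ext i
  fin_cases i <;>
    simp [tau, Matrix.GeneralLinearGroup.mkOfDetNeZero, Units.smul_def, Matrix.mulVec]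

lemma sigma_smul_mem_orbit {p q : Plane} (h : q ∈ MulAction.orbit G p) :
    (Matrix.ProjGenLinGroup.mk sigma : PGL(Fin 3, ℂ)) • q ∈ MulAction.orbit G p := by
  rw [← MulAction.orbit_eq_iff.2 h]
  exact ⟨⟨_, Subgroup.subset_closure (.inl rfl)⟩, rfl⟩

lemma tau_smul_mem_orbit {p q : Plane} (h : q ∈ MulAction.orbit G p) :
    (Matrix.ProjGenLinGroup.mk tau : PGL(Fin 3, ℂ)) • q ∈ MulAction.orbit G p := by
  rw [← MulAction.orbit_eq_iff.2 h]
  exact ⟨⟨_, Subgroup.subset_closure (.inr rfl)⟩, rfl⟩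

lemma swap_mem_orbit {p : Plane} (h : affinePoint x y ∈ MulAction.orbit G p) :
    affinePoint y x ∈ MulAction.orbit G p := by
  simpa [sigma_smul] using sigma_smul_mem_orbit h

lemma neg_fst_mem_orbit {p : Plane} (h : affinePoint x y ∈ MulAction.orbit G p) :
    affinePoint (-x) y ∈ MulAction.orbit G p := by
  simpa [sigma_smul, tau_smul] using sigma_smul_mem_orbit (tau_smul_mem_orbit h)

lemma neg_snd_mem_orbit {p : Plane} (h : affinePoint x y ∈ MulAction.orbit G p) :
    affinePoint x (-y) ∈ MulAction.orbit G p := by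
  simpa [sigma_smul, tau_smul] using tau_smul_mem_orbit (sigma_smul_mem_orbit h)

lemma sq_mem_orbit {p : Plane} {x' y' : ℂ} (h : affinePoint x y ∈ MulAction.orbit G p)
    (hx : x' ^ 2 = x ^ 2) (hy : y' ^ 2 = y ^ 2) : affinePoint x' y' ∈ MulAction.orbit G p := by
  rcases sq_eq_sq_iff_eq_or_eq_neg.1 hx with rfl | rfl <;>
    rcases sq_eq_sq_iff_eq_or_eq_neg.1 hy with rfl | rfl
  · exact h
  · exact neg_snd_mem_orbit h
  · exact neg_fst_mem_orbit h
  · exact neg_fst_mem_orbit (neg_snd_mem_orbit h)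

lemma smul_mem_fiber {g : PGL(Fin 3, ℂ)} (hg : g ∈ G) {p : Plane} (hp : p ∈ fiber a b s) :
    g • p ∈ fiber a b s := by
  suffices H : ∀ p ∈ fiber a b s, g • p ∈ fiber a b s ∧ g⁻¹ • p ∈ fiber a b s from (H p hp).1
  induction hg using Subgroup.closure_induction with
  | mem g hg =>
    rintro _ ⟨x, y, rfl, h1, h2⟩
    rcases hg with rfl | rfl
    · have : (Matrix.ProjGenLinGroup.mk sigma : PGL(Fin 3, ℂ))⁻¹ • affinePoint x y =
          affinePoint y x := by rw [inv_smul_eq_iff, sigma_smul]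
      rw [this, sigma_smul, and_self]
      exact ⟨y, x, rfl, by rw [← h1, add_comm], by rw [← h2]; ring⟩
    · have : (Matrix.ProjGenLinGroup.mk tau : PGL(Fin 3, ℂ))⁻¹ • affinePoint x y =
          affinePoint (-y) x := by rw [inv_smul_eq_iff, tau_smul, neg_neg]
      rw [this, tau_smul]
      exact ⟨⟨y, -x, rfl, by rw [← h1]; ring, by rw [← h2]; ring⟩,
        ⟨-y, x, rfl, by rw [← h1]; ring, by rw [← h2]; ring⟩⟩
  | one => intro p hp; simpa using hp
  | mul g g' _ _ h h' =>
    intro p hp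
    rw [mul_smul, mul_inv_rev, mul_smul]
    exact ⟨(h _ (h' p hp).1).1, (h' _ (h p hp).2).2⟩
  | inv g _ h => exact fun p hp => ⟨(h p hp).2, by simpa using (h p hp).1⟩

lemma sq_eq_of_mem_fiber {x' y' : ℂ} (h : Admissible a b) (hp : affinePoint x y ∈ fiber a b s)
    (hp' : affinePoint x' y' ∈ fiber a b s) :
    x' ^ 2 = x ^ 2 ∧ y' ^ 2 = y ^ 2 ∨ x' ^ 2 = y ^ 2 ∧ y' ^ 2 = x ^ 2 := by
  obtain ⟨h3, h4⟩ := affinePoint_mem_fiber.1 hp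
  obtain ⟨h1, h2⟩ := affinePoint_mem_fiber.1 hp'
  rw [affineQuartic_eq_zero_iff] at h1 h3
  rw [h2] at h1
  rw [h4, ← h1] at h3
  have h5 := mul_left_cancel₀ (sub_ne_zero.2 h.a_ne.symm) h3
  have h6 : (x' ^ 2 - x ^ 2) * (x' ^ 2 - y ^ 2) = 0 := by
    linear_combination x' ^ 2 * (h2 - h4) + h5
  rcases mul_eq_zero.1 h6 with h7 | h7
  · exact .inl ⟨by linear_combination h7, by linear_combination h2 - h4 - h7⟩
  · exact .inr ⟨by linear_combination h7, by linear_combination h2 - h4 - h7⟩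

/-- The map `[x : y : 1] ↦ x² + y²` separates the orbits on the quartic, because `x² y²` is a
function of `x² + y²` there. -/
lemma fiber_eq_orbit (h : Admissible a b) (hp : affinePoint x y ∈ fiber a b s) :
    fiber a b s = MulAction.orbit G (affinePoint x y) := by
  refine Set.Subset.antisymm ?_ ?_
  · rintro _ ⟨x', y', rfl, h1, h2⟩
    have hself := MulAction.mem_orbit_self (M := G) (affinePoint x y)
    rcases sq_eq_of_mem_fiber h hp ⟨x', y', rfl, h1, h2⟩ with ⟨hx, hy⟩ | ⟨hx, hy⟩
    · exact sq_mem_orbit hself hx hy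
    · exact sq_mem_orbit (swap_mem_orbit hself) hx hy
  · rintro _ ⟨⟨g, hg⟩, rfl⟩
    exact smul_mem_fiber hg hp

lemma affinePoint_injective : Function.Injective fun p : ℂ × ℂ => affinePoint p.1 p.2 :=
  fun _ _ h => Prod.ext_iff.2 (affinePoint_inj.1 h)

/-- The points over `s` are those obtained from one of them by sign changes and by the exchange of
`x` and `y`. -/
lemma ncard_fiber_eq_card (h : Admissible a b) (hp : affinePoint x y ∈ fiber a b s) :
    (fiber a b s).ncard =
      (({x, -x} : Finset ℂ) ×ˢ {y, -y} ∪ ({y, -y} : Finset ℂ) ×ˢ {x, -x}).card := by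
  rw [← Set.ncard_coe_finset, ← Set.ncard_image_of_injective _ affinePoint_injective]
  congr 1
  ext p
  simp only [Set.mem_image, Finset.mem_coe, Finset.mem_union, Finset.mem_product,
    Finset.mem_insert, Finset.mem_singleton, ← sq_eq_sq_iff_eq_or_eq_neg, Prod.exists]
  constructor
  · rintro ⟨x', y', rfl, h'⟩
    exact ⟨x', y', sq_eq_of_mem_fiber h hp ⟨x', y', rfl, h'⟩, rfl⟩
  · rintro ⟨x', y', h', rfl⟩
    obtain ⟨h1, h2⟩ := affinePoint_mem_fiber.1 hp
    rw [affineQuartic_eq_zero_iff, h2] at h1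
    rcases h' with ⟨hx, hy⟩ | ⟨hx, hy⟩
    · exact ⟨x', y', rfl, by rw [hx, hy, h2], by rw [hx, hy, h1]⟩
    · exact ⟨x', y', rfl, by rw [hx, hy, ← h2, add_comm], by rw [hx, hy, ← h1]; ring⟩

lemma card_pair_neg (hx : x ≠ 0) : ({x, -x} : Finset ℂ).card = 2 :=
  Finset.card_pair (self_ne_neg.2 hx)

lemma isAxisRoot_iff (hr : flexCubic a b s = 0) (h : Admissible a b)
    (hp : affinePoint x y ∈ fiber a b s) : IsAxisRoot a b s ↔ x = 0 ∨ y = 0 := by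
  obtain ⟨h1, h2⟩ := affinePoint_mem_fiber.1 hp
  rw [affineQuartic_eq_zero_iff, h2] at h1
  rw [IsAxisRoot, ← h1]
  simp [hr, sub_eq_zero, h.a_ne.symm]

lemma isDiagonalRoot_iff (hr : flexCubic a b s = 0) (h : Admissible a b)
    (hp : affinePoint x y ∈ fiber a b s) : IsDiagonalRoot a b s ↔ x ^ 2 = y ^ 2 := by
  obtain ⟨h1, h2⟩ := affinePoint_mem_fiber.1 hp
  rw [affineQuartic_eq_zero_iff, h2] at h1
  have : (2 + a) * s ^ 2 + 4 * b * s + 4 = (a - 2) * (x ^ 2 - y ^ 2) ^ 2 := by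
    linear_combination -4 * h1 + (2 - a) * (s + x ^ 2 + y ^ 2) * h2
  rw [IsDiagonalRoot, this]
  simp [hr, sub_eq_zero, h.a_ne]

lemma ncard_fiber_of_isAxisRoot (h : Admissible a b) (hs : IsAxisRoot a b s) :
    (fiber a b s).ncard = 4 := by
  obtain ⟨x, y, hp⟩ := exists_mem_fiber h s
  have hd := mt (isDiagonalRoot_iff hs.1 h hp).2 (hs.not_isDiagonalRoot h)
  have key : ∀ z : ℂ, z ≠ 0 →
      (({0} : Finset ℂ) ×ˢ {z, -z} ∪ ({z, -z} : Finset ℂ) ×ˢ {0}).card = 4 := by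
    intro z hz
    rw [Finset.card_union_of_disjoint, Finset.card_product, Finset.card_product, card_pair_neg hz,
      Finset.card_singleton]
    refine Finset.disjoint_product.2 (.inl ?_)
    simp [hz.symm, hz]
  rw [ncard_fiber_eq_card h hp]
  rcases (isAxisRoot_iff hs.1 h hp).1 hs with rfl | rfl
  · simpa using key y (by rintro rfl; exact hd rfl)
  · rw [Finset.union_comm]
    simpa using key x (by rintro rfl; exact hd rfl)

/-- On a diagonal the two halves of the generic orbit in `ncard_fiber_eq_card` coincide. -/
lemma ncard_fiber_of_isDiagonalRoot (h : Admissible a b) (hs : IsDiagonalRoot a b s) :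
    (fiber a b s).ncard = 4 := by
  obtain ⟨x, y, hp⟩ := exists_mem_fiber h s
  have hx := mt (isAxisRoot_iff hs.1 h hp).2 fun h' => h'.not_isDiagonalRoot h hs
  push Not at hx
  have hxy : ({x, -x} : Finset ℂ) = {y, -y} := by
    rcases sq_eq_sq_iff_eq_or_eq_neg.1 ((isDiagonalRoot_iff hs.1 h hp).1 hs) with rfl | rfl
    · rfl
    · rw [neg_neg, Finset.pair_comm]
  rw [ncard_fiber_eq_card h hp, hxy, Finset.union_self, Finset.card_product, card_pair_neg hx.2]

lemma ncard_fiber (h : Admissible a b) (hr : flexCubic a b s = 0) (h1 : ¬ IsAxisRoot a b s)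
    (h2 : ¬ IsDiagonalRoot a b s) : (fiber a b s).ncard = 8 := by
  obtain ⟨x, y, hp⟩ := exists_mem_fiber h s
  rw [isAxisRoot_iff hr h hp] at h1
  push Not at h1
  rw [isDiagonalRoot_iff hr h hp, sq_eq_sq_iff_eq_or_eq_neg] at h2
  push Not at h2
  rw [ncard_fiber_eq_card h hp, Finset.card_union_of_disjoint, Finset.card_product,
    Finset.card_product, card_pair_neg h1.1, card_pair_neg h1.2]
  refine Finset.disjoint_product.2 (.inl ?_)
  have hy : y ≠ -x := fun e => h2.2 (by rw [e, neg_neg])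
  simp [h2.1.symm, hy, neg_eq_iff_eq_neg]

end

section

variable {a b s : ℂ}

/-! ### From roots of the cubic to orbits of flexes -/

/-- Orbits of positive `ncard` are finite, and distinct orbits are disjoint. -/
lemma HasOrbitSizes.encard_eq {S : Set Plane} {m : Multiset ℕ} (h : HasOrbitSizes S m)
    (hm : 0 ∉ m) : S.encard = (m.sum : ℕ) := by
  obtain ⟨T, hT, rfl, rfl⟩ := h
  induction T using Finset.induction_on with
  | empty => simp
  | insert O T hO ih =>
    rw [Finset.insert_val_of_notMem hO, Multiset.map_cons] at hm ⊢
    rw [Multiset.mem_cons, not_or] at hm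
    rw [Finset.set_biUnion_insert, Set.encard_union_eq, Multiset.sum_cons, Nat.cast_add,
      ih (fun O' h' => hT O' (Finset.mem_insert_of_mem h')) hm.2,
      (Set.finite_of_ncard_ne_zero (Ne.symm hm.1)).cast_ncard_eq]
    rw [Set.disjoint_iUnion₂_right]
    intro O' h'
    obtain ⟨p, rfl⟩ := hT O (Finset.mem_insert_self _ _)
    obtain ⟨p', rfl⟩ := hT O' (Finset.mem_insert_of_mem h')
    refine (MulAction.orbit.eq_or_disjoint p p').resolve_left fun e => hO (e ▸ h')

lemma fiber_injective (h : Admissible a b) : Function.Injective (fiber a b) := by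
  intro s t hst
  obtain ⟨x, y, hp⟩ := exists_mem_fiber h s
  rw [← (affinePoint_mem_fiber.1 hp).2]
  rw [hst] at hp
  exact (affinePoint_mem_fiber.1 hp).2

lemma hasOrbitSizes_biUnion_fiber (h : Admissible a b) (A : Finset ℂ) :
    HasOrbitSizes (⋃ s ∈ A, fiber a b s) (A.val.map fun s => (fiber a b s).ncard) := by
  refine ⟨A.map ⟨fiber a b, fiber_injective h⟩, ?_, ?_, ?_⟩
  · intro O hO
    obtain ⟨s, -, rfl⟩ := Finset.mem_map.1 hO
    obtain ⟨x, y, hp⟩ := exists_mem_fiber h s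
    exact ⟨_, fiber_eq_orbit h hp⟩
  · simp
  · simp

/-- A root of the cubic over which the flexes are hyperflexes. -/
def IsHyperRoot (a b s : ℂ) : Prop :=
  flexCubic a b s = 0 ∧ (IsAxisRoot a b s ∨ IsDiagonalRoot a b s ∨ flexCubicDeriv a b s = 0)

/-- A root of the cubic over which the flexes are ordinary. -/
def IsOrdinaryRoot (a b s : ℂ) : Prop :=
  flexCubic a b s = 0 ∧ ¬ (IsAxisRoot a b s ∨ IsDiagonalRoot a b s ∨ flexCubicDeriv a b s = 0)

lemma affinePoint_mem_fiber_iff {x y : ℂ} (h : Admissible a b)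
    (hp : affinePoint x y ∈ flexes (quartic a b)) :
    affinePoint x y ∈ fiber a b s ↔ s = x ^ 2 + y ^ 2 := by
  rw [affinePoint_mem_fiber, eq_comm (a := s), and_iff_right ((affinePoint_mem_flexes h).1 hp).1]

/-- The criterion for a hyperflex, in terms of the root of the cubic below the flex. -/
lemma degenerate_iff {x y : ℂ} (h : Admissible a b)
    (hp : affinePoint x y ∈ flexes (quartic a b)) :
    x * y * (x ^ 2 - y ^ 2) = 0 ∨ flexCubicDeriv a b (x ^ 2 + y ^ 2) = 0 ↔
      IsAxisRoot a b (x ^ 2 + y ^ 2) ∨ IsDiagonalRoot a b (x ^ 2 + y ^ 2) ∨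
        flexCubicDeriv a b (x ^ 2 + y ^ 2) = 0 := by
  have hf := (affinePoint_mem_fiber_iff h hp).2 rfl
  have hr := ((affinePoint_mem_flexes h).1 hp).2
  rw [isAxisRoot_iff hr h hf, isDiagonalRoot_iff hr h hf, mul_eq_zero, mul_eq_zero, sub_eq_zero,
    or_assoc]

lemma ordinaryFlexes_eq (h : Admissible a b) {A : Finset ℂ}
    (hA : ∀ s, s ∈ A ↔ IsOrdinaryRoot a b s) :
    ordinaryFlexes (quartic a b) = ⋃ s ∈ A, fiber a b s := by
  ext p
  simp only [Set.mem_iUnion, exists_prop, hA]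
  constructor
  · intro hp
    obtain ⟨x, y, rfl⟩ := exists_eq_affinePoint (rep_two_ne_zero h hp.1)
    obtain ⟨hf, hn⟩ := (affinePoint_mem_ordinaryFlexes h).1 hp
    rw [degenerate_iff h hf] at hn
    exact ⟨_, ⟨((affinePoint_mem_flexes h).1 hf).2, hn⟩, (affinePoint_mem_fiber_iff h hf).2 rfl⟩
  · rintro ⟨s, ⟨hr, hn⟩, hp⟩
    obtain ⟨x, y, rfl, -⟩ := id hp
    obtain ⟨h1, rfl⟩ := affinePoint_mem_fiber.1 hp
    have hf := (affinePoint_mem_flexes h).2 ⟨h1, hr⟩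
    rw [← degenerate_iff h hf] at hn
    exact (affinePoint_mem_ordinaryFlexes h).2 ⟨hf, hn⟩

lemma hyperflexes_eq (h : Admissible a b) {A : Finset ℂ}
    (hA : ∀ s, s ∈ A ↔ IsHyperRoot a b s) :
    hyperflexes (quartic a b) = ⋃ s ∈ A, fiber a b s := by
  ext p
  simp only [Set.mem_iUnion, exists_prop, hA]
  constructor
  · intro hp
    obtain ⟨x, y, rfl⟩ := exists_eq_affinePoint (rep_two_ne_zero h hp.1)
    obtain ⟨hf, hn⟩ := (affinePoint_mem_hyperflexes h).1 hp
    rw [degenerate_iff h hf] at hn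
    exact ⟨_, ⟨((affinePoint_mem_flexes h).1 hf).2, hn⟩, (affinePoint_mem_fiber_iff h hf).2 rfl⟩
  · rintro ⟨s, ⟨hr, hn⟩, hp⟩
    obtain ⟨x, y, rfl, -⟩ := id hp
    obtain ⟨h1, rfl⟩ := affinePoint_mem_fiber.1 hp
    have hf := (affinePoint_mem_flexes h).2 ⟨h1, hr⟩
    rw [← degenerate_iff h hf] at hn
    exact (affinePoint_mem_hyperflexes h).2 ⟨hf, hn⟩

lemma ordinaryFlexes_orbits (h : Admissible a b) {A : Finset ℂ}
    (hA : ∀ s, s ∈ A ↔ IsOrdinaryRoot a b s) :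
    (ordinaryFlexes (quartic a b)).encard = ((Multiset.replicate A.card 8).sum : ℕ) ∧
      HasOrbitSizes (ordinaryFlexes (quartic a b)) (Multiset.replicate A.card 8) := by
  have := hasOrbitSizes_biUnion_fiber h A
  rw [← ordinaryFlexes_eq h hA, Multiset.map_congr rfl (g := fun _ => 8), Multiset.map_const'] at this
  · refine ⟨this.encard_eq ?_, this⟩
    simp [Multiset.mem_replicate]
  · intro s hs
    obtain ⟨hr, hn⟩ := (hA s).1 hs
    push Not at hn
    exact ncard_fiber h hr hn.1 hn.2.1

/-- The roots are split as `A`, the axis and diagonal roots, and `B`, the other hyperflex roots. -/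
lemma hyperflexes_orbits (h : Admissible a b) {A B : Finset ℂ}
    (hA : ∀ s, s ∈ A ↔ IsAxisRoot a b s ∨ IsDiagonalRoot a b s)
    (hB : ∀ s, s ∈ B ↔ flexCubic a b s = 0 ∧ flexCubicDeriv a b s = 0) :
    (hyperflexes (quartic a b)).encard =
        ((Multiset.replicate A.card 4 + Multiset.replicate B.card 8).sum : ℕ) ∧
      HasOrbitSizes (hyperflexes (quartic a b))
        (Multiset.replicate A.card 4 + Multiset.replicate B.card 8) := by
  have hd : Disjoint A B := by
    rw [Finset.disjoint_left]
    intro s h1 h2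
    rcases (hA s).1 h1 with h1 | h1
    · exact h1.flexCubicDeriv_ne h ((hB s).1 h2).2
    · exact h1.flexCubicDeriv_ne h ((hB s).1 h2).2
  have hAB : ∀ s, s ∈ A.disjUnion B hd ↔ IsHyperRoot a b s := by
    intro s
    rw [Finset.mem_disjUnion, hA, hB, IsHyperRoot, IsAxisRoot, IsDiagonalRoot]
    tauto
  have := hasOrbitSizes_biUnion_fiber h (A.disjUnion B hd)
  rw [← hyperflexes_eq h hAB, Finset.disjUnion_val, Multiset.map_add,
    Multiset.map_congr (s := A.val) rfl (g := fun _ => 4),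
    Multiset.map_congr (s := B.val) rfl (g := fun _ => 8),
    Multiset.map_const', Multiset.map_const'] at this
  · refine ⟨this.encard_eq ?_, this⟩
    simp [Multiset.mem_replicate]
  · intro s hs
    obtain ⟨hr, h0⟩ := (hB s).1 hs
    exact ncard_fiber h hr (fun h' => h'.flexCubicDeriv_ne h h0)
      (fun h' => h'.flexCubicDeriv_ne h h0)
  · intro s hs
    rcases (hA s).1 hs with h1 | h1
    · exact ncard_fiber_of_isAxisRoot h h1
    · exact ncard_fiber_of_isDiagonalRoot h h1

/-! ### The root pattern of the cubic -/

/-- The cubic and its derivative, factored over `ℂ`. -/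
lemma exists_roots (h : Admissible a b) : ∃ r₁ r₂ r₃ : ℂ, ∀ s,
    flexCubic a b s = b * (a + 2) * ((s - r₁) * (s - r₂) * (s - r₃)) ∧
    flexCubicDeriv a b s = b * (a + 2) *
      ((s - r₂) * (s - r₃) + (s - r₁) * (s - r₃) + (s - r₁) * (s - r₂)) := by
  let C : Cubic ℂ := ⟨b * (a + 2), 6 * (a + 2), 3 * b * (6 + a - b ^ 2), 2 * (6 + a - b ^ 2)⟩
  have hC : C.a ≠ 0 := mul_ne_zero h.b_ne h.a_add
  obtain ⟨r₁, r₂, r₃, e⟩ := (Cubic.splits_iff_roots_eq_three (φ := RingHom.id ℂ) hC).1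
    (IsAlgClosed.splits _)
  have e1 := Cubic.b_eq_three_roots hC e
  have e2 := Cubic.c_eq_three_roots hC e
  have e3 := Cubic.d_eq_three_roots hC e
  simp only [RingHom.id_apply, C] at e1 e2 e3
  refine ⟨r₁, r₂, r₃, fun s => ⟨?_, ?_⟩⟩
  · unfold flexCubic
    linear_combination s ^ 2 * e1 + s * e2 + e3
  · unfold flexCubicDeriv
    linear_combination 2 * s * e1 + e2

/-- The cubic has either three simple roots, or one simple and one double root. -/
lemma root_pattern (h : Admissible a b) : ∃ R : Finset ℂ, (∀ s, s ∈ R ↔ flexCubic a b s = 0) ∧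
    (R.card = 3 ∧ (∀ s ∈ R, flexCubicDeriv a b s ≠ 0) ∨
      R.card = 2 ∧ ∃ t ∈ R, ∀ s ∈ R, flexCubicDeriv a b s = 0 ↔ s = t) := by
  have hc : b * (a + 2) ≠ 0 := mul_ne_zero h.b_ne h.a_add
  -- the case in which the second and the third of the three roots coincide
  have double : ∀ r t : ℂ, (∀ s,
      flexCubic a b s = b * (a + 2) * ((s - r) * (s - t) * (s - t)) ∧
      flexCubicDeriv a b s = b * (a + 2) *
        ((s - t) * (s - t) + (s - r) * (s - t) + (s - r) * (s - t))) →
      ∃ R : Finset ℂ, (∀ s, s ∈ R ↔ flexCubic a b s = 0) ∧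
        R.card = 2 ∧ ∃ t ∈ R, ∀ s ∈ R, flexCubicDeriv a b s = 0 ↔ s = t := by
    intro r t H
    have hrt : r ≠ t := by
      rintro rfl
      exact flexCubic_ne_cube h r fun s => by rw [(H s).1]; ring
    refine ⟨{r, t}, fun s => ?_, Finset.card_pair hrt, t, by simp, fun s hs => ?_⟩
    · rw [(H s).1, mul_eq_zero_iff_left hc]
      simp [sub_eq_zero]
    · rw [(H s).2, mul_eq_zero_iff_left hc]
      rcases (by simpa using hs : s = r ∨ s = t) with rfl | rfl
      · simp [sub_eq_zero]
      · simp
  obtain ⟨r₁, r₂, r₃, H⟩ := exists_roots h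
  by_cases h12 : r₁ = r₂
  · subst h12
    obtain ⟨R, hR, hR'⟩ := double r₃ r₁ fun s => ⟨by rw [(H s).1]; ring, by rw [(H s).2]; ring⟩
    exact ⟨R, hR, .inr hR'⟩
  by_cases h13 : r₁ = r₃
  · subst h13
    obtain ⟨R, hR, hR'⟩ := double r₂ r₁ fun s => ⟨by rw [(H s).1]; ring, by rw [(H s).2]; ring⟩
    exact ⟨R, hR, .inr hR'⟩
  by_cases h23 : r₂ = r₃
  · subst h23
    obtain ⟨R, hR, hR'⟩ := double r₁ r₂ H
    exact ⟨R, hR, .inr hR'⟩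
  refine ⟨{r₁, r₂, r₃}, fun s => ?_, .inl ⟨Finset.card_eq_three.2 ⟨_, _, _, h12, h13, h23, rfl⟩,
    fun s hs => ?_⟩⟩
  · rw [(H s).1, mul_eq_zero_iff_left hc]
    simp [sub_eq_zero, or_assoc]
  · rw [(H s).2]
    refine mul_ne_zero hc ?_
    rcases (by simpa using hs : s = r₁ ∨ s = r₂ ∨ s = r₃) with rfl | rfl | rfl
    · simp [sub_eq_zero, h12, h13]
    · simp [sub_eq_zero, Ne.symm h12, h23]
    · simp [sub_eq_zero, Ne.symm h13, Ne.symm h23]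

/-- With `A` the set of axis and diagonal roots, `k` the number of double roots and `n` the number
of the remaining roots, the degree of the cubic gives `A.card + 2 k + n = 3`. -/
lemma exists_orbits (h : Admissible a b) {A : Finset ℂ}
    (hA : ∀ s, s ∈ A ↔ IsAxisRoot a b s ∨ IsDiagonalRoot a b s) :
    ∃ k n : ℕ, A.card + 2 * k + n = 3 ∧
      ((ordinaryFlexes (quartic a b)).encard = ((Multiset.replicate n 8).sum : ℕ) ∧
        HasOrbitSizes (ordinaryFlexes (quartic a b)) (Multiset.replicate n 8)) ∧
      (hyperflexes (quartic a b)).encard =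
        ((Multiset.replicate A.card 4 + Multiset.replicate k 8).sum : ℕ) ∧
      HasOrbitSizes (hyperflexes (quartic a b))
        (Multiset.replicate A.card 4 + Multiset.replicate k 8) := by
  obtain ⟨R, hR, hcard⟩ := root_pattern h
  have hAR : A ⊆ R := by
    intro s hs
    rw [hR]
    exact ((hA s).1 hs).elim And.left And.left
  have hA' : ∀ s ∈ A, flexCubicDeriv a b s ≠ 0 := fun s hs =>
    ((hA s).1 hs).elim (fun h' => h'.flexCubicDeriv_ne h) fun h' => h'.flexCubicDeriv_ne h
  rcases hcard with ⟨hc, hd⟩ | ⟨hc, t, ht, hd⟩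
  · refine ⟨0, (R \ A).card, ?_, ordinaryFlexes_orbits h fun s => ?_,
      hyperflexes_orbits h (B := ∅) hA fun s => ?_⟩
    · have := Finset.card_sdiff_add_card_eq_card hAR
      lia
    · have := hd s
      rw [Finset.mem_sdiff, hA, IsOrdinaryRoot, hR] at *
      tauto
    · have := hd s
      rw [hR] at this
      simpa using this
  · have htA : t ∉ A := fun h' => hA' t h' ((hd t ht).2 rfl)
    have hAR' : insert t A ⊆ R := Finset.insert_subset ht hAR
    refine ⟨1, (R \ insert t A).card, ?_, ordinaryFlexes_orbits h fun s => ?_,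
      hyperflexes_orbits h (B := {t}) hA fun s => ?_⟩
    · have := Finset.card_sdiff_add_card_eq_card hAR'
      rw [Finset.card_insert_of_notMem htA] at this
      lia
    · have := hd s
      rw [Finset.mem_sdiff, Finset.mem_insert, hA, IsOrdinaryRoot, hR] at *
      tauto
    · rw [Finset.mem_singleton, ← hR]
      exact ⟨by rintro rfl; exact ⟨ht, (hd s ht).2 rfl⟩, fun h' => (hd s h'.1).1 h'.2⟩

lemma exists_isAxisRoot_iff_eq (h : Admissible a b) (hP : P a b = 0) :
    ∃ t, ∀ s, IsAxisRoot a b s ↔ s = t := by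
  obtain ⟨t, ht⟩ := exists_isAxisRoot h hP
  refine ⟨t, fun s => ⟨fun hs => ?_, by rintro rfl; exact ht⟩⟩
  have h1 := (hs.eq h).1
  have ha : a ≠ 0 := by rintro rfl; exact h.b_ne (by simpa using h1)
  exact mul_left_cancel₀ ha (by linear_combination h1 - (ht.eq h).1)

lemma exists_isDiagonalRoot_iff_eq (h : Admissible a b) (hQ : Q a b = 0) :
    ∃ t, ∀ s, IsDiagonalRoot a b s ↔ s = t := by
  obtain ⟨t, ht⟩ := exists_isDiagonalRoot h hQ
  refine ⟨t, fun s => ⟨fun hs => ?_, by rintro rfl; exact ht⟩⟩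
  have h1 := (hs.eq h).1
  have ha : 6 - a ≠ 0 := fun h6 => h.b_ne (by simpa [h6] using h1)
  exact mul_left_cancel₀ ha (by linear_combination h1 - (ht.eq h).1)

end

end Kuribayashi

/-! ### The flexes of the quartic -/

theorem theorem2p14 (a b : ℂ) (hb : b ≠ 0)
    (hab : (a ^ 2 - 4) * (b ^ 2 - 4) * (a ^ 2 - 1) * (b ^ 2 - a - 2) ≠ 0) :
    -- every flex is an ordinary flex or a hyperflex
    Kuribayashi.flexes (Kuribayashi.quartic a b) =
      Kuribayashi.ordinaryFlexes (Kuribayashi.quartic a b) ∪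
        Kuribayashi.hyperflexes (Kuribayashi.quartic a b) ∧
    -- both polynomials vanish
    (Kuribayashi.P a b = 0 ∧ Kuribayashi.Q a b = 0 →
      (Kuribayashi.ordinaryFlexes (Kuribayashi.quartic a b)).encard = 8 ∧
      Kuribayashi.HasOrbitSizes (Kuribayashi.ordinaryFlexes (Kuribayashi.quartic a b)) {8} ∧
      (Kuribayashi.hyperflexes (Kuribayashi.quartic a b)).encard = 8 ∧
      Kuribayashi.HasOrbitSizes (Kuribayashi.hyperflexes (Kuribayashi.quartic a b)) {4, 4}) ∧
    -- exactly one of them vanishes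
    ((Kuribayashi.P a b = 0 ∧ Kuribayashi.Q a b ≠ 0) ∨
        (Kuribayashi.P a b ≠ 0 ∧ Kuribayashi.Q a b = 0) →
      ((Kuribayashi.ordinaryFlexes (Kuribayashi.quartic a b)).encard = 0 ∧
        Kuribayashi.HasOrbitSizes (Kuribayashi.ordinaryFlexes (Kuribayashi.quartic a b)) 0 ∧
        (Kuribayashi.hyperflexes (Kuribayashi.quartic a b)).encard = 12 ∧
        Kuribayashi.HasOrbitSizes (Kuribayashi.hyperflexes (Kuribayashi.quartic a b)) {4, 8}) ∨
      ((Kuribayashi.ordinaryFlexes (Kuribayashi.quartic a b)).encard = 16 ∧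
        Kuribayashi.HasOrbitSizes (Kuribayashi.ordinaryFlexes (Kuribayashi.quartic a b)) {8, 8} ∧
        (Kuribayashi.hyperflexes (Kuribayashi.quartic a b)).encard = 4 ∧
        Kuribayashi.HasOrbitSizes (Kuribayashi.hyperflexes (Kuribayashi.quartic a b)) {4})) ∧
    -- none of them vanishes
    (Kuribayashi.P a b * Kuribayashi.Q a b ≠ 0 →
      ((Kuribayashi.ordinaryFlexes (Kuribayashi.quartic a b)).encard = 24 ∧
        Kuribayashi.HasOrbitSizes (Kuribayashi.ordinaryFlexes (Kuribayashi.quartic a b))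
          {8, 8, 8} ∧
        (Kuribayashi.hyperflexes (Kuribayashi.quartic a b)).encard = 0 ∧
        Kuribayashi.HasOrbitSizes (Kuribayashi.hyperflexes (Kuribayashi.quartic a b)) 0) ∨
      ((Kuribayashi.ordinaryFlexes (Kuribayashi.quartic a b)).encard = 8 ∧
        Kuribayashi.HasOrbitSizes (Kuribayashi.ordinaryFlexes (Kuribayashi.quartic a b)) {8} ∧
        (Kuribayashi.hyperflexes (Kuribayashi.quartic a b)).encard = 8 ∧
        Kuribayashi.HasOrbitSizes (Kuribayashi.hyperflexes (Kuribayashi.quartic a b)) {8})) := by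
  have h : Kuribayashi.Admissible a b := by
    constructor
    · exact hb
    all_goals
      rintro h0
      apply hab
    · rw [h0]; ring
    · linear_combination (a - 2) * (b ^ 2 - 4) * (a ^ 2 - 1) * (b ^ 2 - a - 2) * h0
    · rw [h0]; ring
    · rw [h0]; ring
  refine ⟨Kuribayashi.flexes_eq_union h, ?_, ?_, ?_⟩
  · rintro ⟨hP, hQ⟩
    obtain ⟨t, ht⟩ := Kuribayashi.exists_isAxisRoot_iff_eq h hP
    obtain ⟨u, hu⟩ := Kuribayashi.exists_isDiagonalRoot_iff_eq h hQ
    have htu : t ≠ u := by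
      rintro rfl
      exact ((ht t).2 rfl).not_isDiagonalRoot h ((hu t).2 rfl)
    obtain ⟨k, n, hkn, ho, hh⟩ := Kuribayashi.exists_orbits h (A := {t, u})
      fun s => by simp [ht, hu]
    rw [Finset.card_pair htu] at hkn hh
    obtain ⟨rfl, rfl⟩ : k = 0 ∧ n = 1 := by lia
    exact ⟨ho.1, ho.2, hh.1, hh.2⟩
  · intro hPQ
    obtain ⟨t, ht⟩ : ∃ t, ∀ s, s ∈ ({t} : Finset ℂ) ↔
        Kuribayashi.IsAxisRoot a b s ∨ Kuribayashi.IsDiagonalRoot a b s := by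
      rcases hPQ with ⟨hP, hQ⟩ | ⟨hP, hQ⟩
      · obtain ⟨t, ht⟩ := Kuribayashi.exists_isAxisRoot_iff_eq h hP
        refine ⟨t, fun s => ?_⟩
        rw [ht, or_iff_left fun h' => hQ (h'.eq h).2, Finset.mem_singleton]
      · obtain ⟨t, ht⟩ := Kuribayashi.exists_isDiagonalRoot_iff_eq h hQ
        refine ⟨t, fun s => ?_⟩
        rw [ht, or_iff_right fun h' => hP (h'.eq h).2, Finset.mem_singleton]
    obtain ⟨k, n, hkn, ho, hh⟩ := Kuribayashi.exists_orbits h ht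
    rw [Finset.card_singleton] at hkn hh
    obtain ⟨rfl, rfl⟩ | ⟨rfl, rfl⟩ : k = 1 ∧ n = 0 ∨ k = 0 ∧ n = 2 := by lia
    · exact .inl ⟨ho.1, ho.2, hh.1, hh.2⟩
    · exact .inr ⟨ho.1, ho.2, hh.1, hh.2⟩
  · intro hPQ
    obtain ⟨hP, hQ⟩ := mul_ne_zero_iff.1 hPQ
    obtain ⟨k, n, hkn, ho, hh⟩ := Kuribayashi.exists_orbits h (A := ∅) fun s => by
      simpa using And.intro (fun h' : Kuribayashi.IsAxisRoot a b s => hP (h'.eq h).2)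
        fun h' : Kuribayashi.IsDiagonalRoot a b s => hQ (h'.eq h).2
    rw [Finset.card_empty] at hkn hh
    obtain ⟨rfl, rfl⟩ | ⟨rfl, rfl⟩ : k = 0 ∧ n = 3 ∨ k = 1 ∧ n = 1 := by lia
    · exact .inl ⟨ho.1, ho.2, hh.1, hh.2⟩
    · exact .inr ⟨ho.1, ho.2, hh.1, hh.2⟩
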